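/- Conventions. Let $\mathcal A$ be a set system, i.e. a set of sets. A \emph{weak conflict free coloring of $\mathcal A$ with $\rho$ colors} is a partial function $f$ with $\operatorname{dom}(f)\subseteq\bigcup\mathcal A$ and values in $\rho$ such that for every $A\in\mathcal A$ there is a color $\zeta<\rho$ with $|A\cap f^{-1}\{\zeta\}|=1$. The \emph{weak conflict free chromatic number} $w\chi_{\rm CF}(\mathcal A)$ is the least cardinal $\rho$ for which $\mathcal A$ has a weak conflict free coloring with $\rho$ colors. For cardinals $\lambda\ge\kappa\ge\mu$ with $\lambda$ infinite, $\mathcal A$ is a \emph{$(\lambda,\kappa,\mu)$-system} if $|\mathcal A|=\lambda$, $|A|=\kappa$ for all $A\in\mathcal A$, and $|A\cap A'|<\mu$ for all distinct $A,A'\in\mathcal A$. Let $$w\chi_{\rm CF}(\lambda,\kappa,\mu)=\sup\{w\chi_{\rm CF}(\mathcal A):\mathcal A\text{ is a }(\lambda,\kappa,\mu)\text{-system}\}.$$ Write $\kappa^{+m}$ for the $m$-th cardinal successor of $\kappa$ (so $\kappa^{+0}=\kappa$). Theorem. Assume GCH, i.e. $2^{\mu}=\mu^{+}$ for every infinite cardinal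 $\mu$. Then for every infinite cardinal $\kappa$ and all integers $m\ge 0$ and $\ell>0$, $$w\chi_{\rm CF}(\kappa^{+m},\kappa,2\ell+1)=(m+1)\cdot\ell+1 .$$ -/

import Mathlib

universe u

namespace ConflictFree

open Cardinal

/-- The generalized continuum hypothesis (for the cardinals of the universe `u`). -/
def GCH : Prop :=
  ∀ μ : Cardinal.{u}, ℵ₀ ≤ μ → (2 : Cardinal.{u}) ^ μ = Order.succ μ

/-- `𝒜` is `μ`-almost disjoint: distinct members meet in a set of size less than `μ`. -/
def AlmostDisjoint {α : Type u} (𝒜 : Set (Set α)) (μ : Cardinal.{u}) : Prop :=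
  ∀ A ∈ 𝒜, ∀ B ∈ 𝒜, A ≠ B → #(A ∩ B : Set α) < μ

/-- `𝒜` is a `(lam, κ, μ)`-system. -/
structure IsSystem {α : Type u} (𝒜 : Set (Set α)) (lam κ μ : Cardinal.{u}) : Prop where
  card_system : #𝒜 = lam
  card_mem : ∀ A ∈ 𝒜, #A = κ
  almostDisjoint : AlmostDisjoint 𝒜 μ

/-- `f` is a weak conflict free coloring of `𝒜` with colors in `C`. The partial function `f` is
encoded with values in `Option C`: `f a = none` means that `a` is not in the domain of `f`. -/
structure IsWeakCFColoring {α C : Type u} (𝒜 : Set (Set α)) (f : α → Option C) : Prop where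
  dom_subset : {a | f a ≠ none} ⊆ ⋃₀ 𝒜
  conflictFree : ∀ A ∈ 𝒜, ∃ ζ : C, #(A ∩ f ⁻¹' {some ζ} : Set α) = 1

/-- The cardinals `ρ` such that `𝒜` has a weak conflict free coloring with `ρ` colors. -/
def weakCFColorCounts {α : Type u} (𝒜 : Set (Set α)) : Set Cardinal.{u} :=
  {ρ | ∃ C : Type u, #C = ρ ∧ ∃ f : α → Option C, IsWeakCFColoring 𝒜 f}

/-- The weak conflict free chromatic number of a set system: the least element of
`weakCFColorCounts 𝒜`. -/
noncomputable def weakCFNumber {α : Type u} (𝒜 : Set (Set α)) : Cardinal.{u} :=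
  sInf (weakCFColorCounts 𝒜)

/-- The weak conflict free chromatic numbers of all `(lam, κ, μ)`-systems. -/
def weakCFNumbers (lam κ μ : Cardinal.{u}) : Set Cardinal.{u} :=
  {ρ | ∃ (α : Type u) (𝒜 : Set (Set α)), IsSystem 𝒜 lam κ μ ∧ ρ = weakCFNumber 𝒜}

/-- The supremum of the weak conflict free chromatic numbers of all `(lam, κ, μ)`-systems. -/
noncomputable def wChiCF (lam κ μ : Cardinal.{u}) : Cardinal.{u} :=
  sSup (weakCFNumbers lam κ μ)

/-- Coloring all points differently works, so the minimum above is over a non-empty set. -/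
theorem mk_sUnion_mem_weakCFColorCounts {α : Type u} (𝒜 : Set (Set α))
    (h : ∀ A ∈ 𝒜, A.Nonempty) : #(⋃₀ 𝒜 : Set α) ∈ weakCFColorCounts 𝒜 := by
  classical
  refine ⟨(⋃₀ 𝒜 : Set α), rfl, fun a => if ha : a ∈ ⋃₀ 𝒜 then some ⟨a, ha⟩ else none, ?_, ?_⟩
  · intro a ha
    by_contra hn
    exact ha (dif_neg hn)
  · intro A hA
    obtain ⟨a, ha⟩ := h A hA
    have hu : ∀ b ∈ A, b ∈ ⋃₀ 𝒜 := fun b hb => ⟨A, hA, hb⟩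
    refine ⟨⟨a, hu a ha⟩, ?_⟩
    have : A ∩ (fun b => if hb : b ∈ ⋃₀ 𝒜 then some (⟨b, hb⟩ : (⋃₀ 𝒜 : Set α)) else none) ⁻¹'
        {some ⟨a, hu a ha⟩} = {a} := by
      ext b
      simp only [Set.mem_inter_iff, Set.mem_preimage, Set.mem_singleton_iff]
      constructor
      · rintro ⟨hb, hb'⟩
        rw [dif_pos (hu b hb)] at hb'
        simpa using hb'
      · rintro rfl
        exact ⟨ha, dif_pos (hu b ha)⟩
    rw [this, mk_singleton]

/-- The supremum above is over a bounded set. -/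
theorem bddAbove_weakCFNumbers (lam κ μ : Cardinal.{u}) (hκ : κ ≠ 0) :
    BddAbove (weakCFNumbers lam κ μ) := by
  refine ⟨lam * κ, ?_⟩
  rintro _ ⟨α, 𝒜, h, rfl⟩
  have hne : ∀ A ∈ 𝒜, A.Nonempty := fun A hA => by
    rw [← Set.nonempty_coe_sort, ← mk_ne_zero_iff, h.card_mem A hA]
    exact hκ
  refine (csInf_le' (mk_sUnion_mem_weakCFColorCounts 𝒜 hne)).trans ?_
  refine (mk_sUnion_le 𝒜).trans ?_
  rw [h.card_system]
  gcongr
  exact ciSup_le' fun A => (h.card_mem A A.2).le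

end ConflictFree

namespace ConflictFree

open Cardinal

/-! Write $k=2\ell$, so distinct members share at most $k$ points.

Upper bound (no GCH needed). Filtering the system $m$ times by trace-closed subsystems ranks its
members so that each rank has at most $\kappa$ of them and each set has at most $mk$ points in sets
of smaller rank (`exists_rank_iterate`). Well-order the system lexicographically, first by rank and
then in type at most $\kappa$ inside each rank. At its stage a set gets, if possible, a point lying
in no earlier set, with a color not yet seen on it. No later point falls into that set, so the new
color stays unique there. The point also avoids sets of the same rank that already contain $k+1$
points assigned within this rank; hence a set contains at most $mk+k+1$ points assigned before its
stage (`card_le_of_stageGood`). If its stage assigns nothing, all colors have been seen on it, and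
were none unique there would be at least $2|C|$ such points. With $|C|=(m+1)\ell+1$ this is one too
many.

Lower bound. A `GuessingFamily` with parameter $n$ defeats $n\ell$ colors: for every coloring some
member sees only colors from a set $D$, and each color of $D$ at least twice. For $n=1$, a freely
generated family has room for two points of each of $\ell$ colors. Passing from $\lambda$ to
$\lambda^+$ adds $\ell$ colors: $\lambda^+$ copies of the old family are stacked, and each set in a
copy receives at most $2\ell$ points from lower copies. GCH allows all candidates for these extra
points to be listed in type $\lambda^+$. Labels let one $D$, fixed in advance, serve every way of
dividing the colors between old and new points. -/

/-- Recursion along a well-founded relation with a choice at each step. -/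
theorem exists_wellFounded_choice {ι β : Type*} [Nonempty β] {r : ι → ι → Prop}
    (hr : WellFounded r) (P : ι → (ι → β) → β → Prop)
    (hcongr : ∀ i g g', (∀ j, r j i → g j = g' j) → ∀ v, P i g v → P i g' v)
    (hex : ∀ i g, ∃ v, P i g v) : ∃ g : ι → β, ∀ i, P i g (g i) := by
  classical
  choose F hF using hex
  have b : β := Classical.arbitrary β
  let G : (i : ι) → ((j : ι) → r j i → β) → β :=
    fun i ih => F i (fun j => if h : r j i then ih j h else b)
  refine ⟨hr.fix G, fun i => ?_⟩
  rw [hr.fix_eq]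
  refine hcongr i _ _ ?_ _ (hF i _)
  intro j hj
  rw [dif_pos hj]

theorem mk_finset_lt {α : Type u} {κ : Cardinal.{u}} (hκ : ℵ₀ ≤ κ) (h : #α < κ) :
    #(Finset α) < κ := by
  cases finite_or_infinite α with
  | inl h => exact (lt_aleph0_of_finite _).trans_le hκ
  | inr h => rwa [mk_finset_of_infinite]

theorem mk_finset_le {α : Type u} {κ : Cardinal.{u}} (hκ : ℵ₀ ≤ κ) (h : #α ≤ κ) :
    #(Finset α) ≤ κ := by
  cases finite_or_infinite α with
  | inl h => exact (lt_aleph0_of_finite _).le.trans hκ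
  | inr h => rwa [mk_finset_of_infinite]

theorem mk_biUnion_le_of_le {ι α : Type u} {κ : Cardinal.{u}} (hκ : ℵ₀ ≤ κ) (s : Set ι)
    (A : ι → Set α) (hs : #s ≤ κ) (hA : ∀ i ∈ s, #(A i) ≤ κ) :
    #(⋃ i ∈ s, A i : Set α) ≤ κ :=
  (mk_biUnion_le A s).trans
    ((mul_le_mul' hs (ciSup_le' fun i : s => hA i i.2)).trans (mul_eq_self hκ).le)

theorem mk_biUnion_finite_lt {ι α : Type u} {κ : Cardinal.{u}} (hκ : ℵ₀ ≤ κ) (s : Set ι)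
    (A : ι → Set α) (hs : #s < κ) (hA : ∀ i ∈ s, (A i).Finite) :
    #(⋃ i ∈ s, A i : Set α) < κ := by
  cases s.finite_or_infinite with
  | inl h => exact (lt_aleph0_iff_set_finite.2 (h.biUnion hA)).trans_le hκ
  | inr h =>
    have h0 : ℵ₀ ≤ #s := aleph0_le_mk_iff.2 h.to_subtype
    exact (mk_biUnion_le_of_le h0 s A le_rfl
      fun i hi => (lt_aleph0_iff_set_finite.2 (hA i hi)).le.trans h0).trans_lt hs

theorem finite_of_forall_card_le {α : Type*} {s : Set α} {n : ℕ}
    (h : ∀ E : Finset α, ↑E ⊆ s → E.card ≤ n) : s.Finite := by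
  by_contra hs
  obtain ⟨E, hE, hc⟩ := Set.Infinite.exists_subset_card_eq hs (n + 1)
  have := h E hE
  omega

theorem mk_Iio_lt_ord {κ : Cardinal.{u}} (i : κ.ord.ToType) : #(Set.Iio i) < κ := by
  simpa using mk_Iio_lt i

/-- A small set in the successor cardinal is strictly bounded. -/
theorem exists_forall_lt_of_mk_le {lam : Cardinal.{u}} (hl : ℵ₀ ≤ lam)
    (s : Set (Order.succ lam).ord.ToType) (hs : #s ≤ lam) : ∃ ξ, ∀ η ∈ s, η < ξ := by
  by_contra! h
  have h1 := Order.cof_le (α := (Order.succ lam).ord.ToType) (s := s) h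
  rw [Ordinal.cof_toType, (isRegular_succ hl).cof_ord] at h1
  exact absurd (h1.trans hs) (not_le.2 (Order.lt_succ lam))

theorem aleph0_le_iterate_succ {κ : Cardinal.{u}} (hκ : ℵ₀ ≤ κ) (m : ℕ) :
    κ ≤ Order.succ^[m] κ ∧ ℵ₀ ≤ Order.succ^[m] κ := by
  have h : κ ≤ Order.succ^[m] κ := by
    induction m with
    | zero => exact le_rfl
    | succ m ih =>
      rw [Function.iterate_succ_apply']
      exact ih.trans (Order.le_succ _)
  exact ⟨h, hκ.trans h⟩

/-- Pairwise disjoint representatives of `lam` many families of `lam` many disjoint finite sets. -/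
theorem exists_disjoint_choice {J I V : Type u} [Infinite I] (hJ : #J ≤ #I)
    (h : J → I → Finset V) (hd : ∀ j s t, s ≠ t → Disjoint (h j s) (h j t)) :
    ∃ g : J → I, ∀ i j, i ≠ j → Disjoint (h i (g i)) (h j (g j)) := by
  classical
  have hI : ℵ₀ ≤ #I := aleph0_le_mk I
  obtain ⟨e⟩ : Nonempty (J ↪ (#I).ord.ToType) := by
    rw [← le_def]; simpa using hJ
  obtain ⟨g, hg⟩ := exists_wellFounded_choice (ι := J) (β := I)
    (r := InvImage (· < ·) e) (InvImage.wf _ wellFounded_lt)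
    (fun j g v => ∀ i, e i < e j → Disjoint (h i (g i)) (h j v)) (by
      intro i g g' hgg v hv j hj
      rw [← hgg j hj]
      exact hv j hj) (by
      intro j g
      -- If every `v` were blocked, picking a blocking point would inject `I` into the fewer than
      -- `#I` points already used, since the sets `h j v` are disjoint.
      by_contra! hcon
      choose i hi hni using hcon
      simp only [Finset.not_disjoint_iff] at hni
      choose x hx1 hx2 using hni
      have hX : #(⋃ i ∈ {i | e i < e j}, (h i (g i) : Set V) : Set V) < #I := by
        refine mk_biUnion_finite_lt hI _ _ ?_ (fun i _ => Finset.finite_toSet _)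
        refine lt_of_le_of_lt ?_ (mk_Iio_lt_ord (e j))
        exact mk_le_of_injective (f := fun i : {i | e i < e j} =>
          (⟨e i, i.2⟩ : Set.Iio (e j))) (fun a b hab => by
            simpa [Subtype.ext_iff] using hab)
      refine absurd (mk_le_of_injective (f := fun v : I =>
        (⟨x v, Set.mem_biUnion (hi v) (hx1 v)⟩ :
          (⋃ i ∈ {i | e i < e j}, (h i (g i) : Set V) : Set V))) ?_) (not_le.2 hX)
      intro v w hvw
      by_contra hne
      have : x v = x w := by simpa using hvw
      exact Finset.disjoint_left.1 (hd j v w hne) (hx2 v) (this ▸ hx2 w))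
  refine ⟨g, fun i j hij => ?_⟩
  rcases lt_or_gt_of_ne (e.injective.ne hij) with h' | h'
  · exact hg j i h'
  · exact (hg i j h').symm

/-! ### Trace-closed subsystems and rank functions -/

section Filtration

variable {α ι : Type u}

/-- `T` contains the index of every set meeting the union over `T` in more than `k` points. -/
def IsTraceClosed (A : ι → Set α) (k : ℕ) (T : Set ι) : Prop :=
  ∀ (i : ι) (E : Finset α), ↑E ⊆ A i → E.card = k + 1 → (∀ x ∈ E, ∃ j ∈ T, x ∈ A j) → i ∈ T

/-- Any $k+1$ points determine at most one member, so a closing step adds no more indices than there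
are finite subsets of the current union. As traces are finite, $\omega$ steps suffice. -/
theorem exists_isTraceClosed (A : ι → Set α) (k : ℕ) {lam : Cardinal.{u}} (hl : ℵ₀ ≤ lam)
    (hA : ∀ i, #(A i) ≤ lam)
    (had : ∀ i j, i ≠ j → ∀ E : Finset α, ↑E ⊆ A i → ↑E ⊆ A j → E.card ≤ k)
    (S : Set ι) (hS : #S ≤ lam) : ∃ T, S ⊆ T ∧ #T ≤ lam ∧ IsTraceClosed A k T := by
  classical
  let step : Set ι → Set ι := fun T => T ∪ {i | ∃ E : Finset α, ↑E ⊆ A i ∧ E.card = k + 1 ∧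
    ∀ x ∈ E, ∃ j ∈ T, x ∈ A j}
  have hstep : ∀ T : Set ι, #T ≤ lam → #(step T) ≤ lam := by
    intro T hT
    refine (mk_union_le _ _).trans (add_le_of_le hl hT ?_)
    have hU : #(⋃ j ∈ T, A j : Set α) ≤ lam := mk_biUnion_le_of_le hl T A hT fun j _ => hA j
    refine le_trans ?_ (mk_finset_le hl hU)
    let F : {i | ∃ E : Finset α, ↑E ⊆ A i ∧ E.card = k + 1 ∧ ∀ x ∈ E, ∃ j ∈ T, x ∈ A j} →
      Finset (⋃ j ∈ T, A j : Set α) := fun i => i.2.choose.subtype _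
    have hmap : ∀ i, (F i).map (Function.Embedding.subtype _) = i.2.choose := by
      intro i
      simp only [F, Finset.subtype_map]
      refine Finset.filter_true_of_mem fun x hx => ?_
      obtain ⟨j, hj, hxj⟩ := i.2.choose_spec.2.2 x hx
      exact Set.mem_biUnion hj hxj
    refine mk_le_of_injective (f := F) fun i j hij => ?_
    by_contra hne
    have h1 : i.2.choose = j.2.choose := by rw [← hmap i, ← hmap j, hij]
    have h2 := had i j (fun h => hne (Subtype.ext h)) _ i.2.choose_spec.1
      (by rw [h1]; exact j.2.choose_spec.1)
    have h3 := i.2.choose_spec.2.1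
    omega
  let Tn : ℕ → Set ι := fun n => step^[n] S
  have hsucc : ∀ n, Tn (n + 1) = step (Tn n) := fun n => Function.iterate_succ_apply' _ _ _
  have hmono : Monotone Tn := monotone_nat_of_le_succ fun n => by
    rw [hsucc]; exact Set.subset_union_left
  have hcard : ∀ n, #(Tn n) ≤ lam := by
    intro n
    induction n with
    | zero => exact hS
    | succ n ih => rw [hsucc]; exact hstep _ ih
  refine ⟨⋃ n, Tn n, Set.subset_iUnion Tn 0, ?_, ?_⟩
  · have := mk_biUnion_le_of_le hl (Set.univ : Set (ULift.{u} ℕ)) (fun n => Tn n.down)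
      (by simpa using hl) (fun n _ => hcard _)
    refine le_trans (mk_le_mk_of_subset ?_) this
    intro x hx
    obtain ⟨n, hn⟩ := Set.mem_iUnion.1 hx
    exact Set.mem_biUnion (Set.mem_univ (ULift.up n)) hn
  · intro i E hE hc hx
    have : ∀ x ∈ E, ∃ n, ∃ j ∈ Tn n, x ∈ A j := by
      intro x h
      obtain ⟨j, hj, hxj⟩ := hx x h
      obtain ⟨n, hn⟩ := Set.mem_iUnion.1 hj
      exact ⟨n, j, hn, hxj⟩
    choose! n hn using this
    refine Set.mem_iUnion.2 ⟨E.sup n + 1, ?_⟩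
    rw [hsucc]
    refine Or.inr ⟨E, hE, hc, fun x h => ?_⟩
    obtain ⟨j, hj, hxj⟩ := hn x h
    exact ⟨j, hmono (Finset.le_sup h) hj, hxj⟩

/-- The least trace closed set containing `S`. -/
def traceClosure (A : ι → Set α) (k : ℕ) (S : Set ι) : Set ι :=
  ⋂₀ {T | S ⊆ T ∧ IsTraceClosed A k T}

theorem subset_traceClosure (A : ι → Set α) (k : ℕ) (S : Set ι) : S ⊆ traceClosure A k S :=
  Set.subset_sInter fun _ hT => hT.1

theorem traceClosure_mono (A : ι → Set α) (k : ℕ) {S S' : Set ι} (h : S ⊆ S') :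
    traceClosure A k S ⊆ traceClosure A k S' :=
  Set.sInter_subset_sInter fun _ hT => ⟨h.trans hT.1, hT.2⟩

theorem isTraceClosed_traceClosure (A : ι → Set α) (k : ℕ) (S : Set ι) :
    IsTraceClosed A k (traceClosure A k S) := by
  intro i E hE hc hx T hT
  refine hT.2 i E hE hc fun x h => ?_
  obtain ⟨j, hj, hxj⟩ := hx x h
  exact ⟨j, hj T hT, hxj⟩

/-- A system of size `lam⁺` is ranked with ranks having `lam` members, so that each set has
at most `k` points in the sets of smaller rank. -/
theorem exists_rank_succ (A : ι → Set α) (k : ℕ) {lam : Cardinal.{u}} (hl : ℵ₀ ≤ lam)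
    (hA : ∀ i, #(A i) ≤ lam)
    (had : ∀ i j, i ≠ j → ∀ E : Finset α, ↑E ⊆ A i → ↑E ⊆ A j → E.card ≤ k)
    (hι : #ι ≤ Order.succ lam) :
    ∃ r : ι → (Order.succ lam).ord.ToType, (∀ ξ, #{i | r i = ξ} ≤ lam) ∧
      ∀ i, ∀ E : Finset α, ↑E ⊆ A i → (∀ x ∈ E, ∃ j, r j < r i ∧ x ∈ A j) → E.card ≤ k := by
  classical
  obtain ⟨e⟩ : Nonempty (ι ↪ (Order.succ lam).ord.ToType) := by
    rw [← le_def]; simpa using hι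
  let cl : (Order.succ lam).ord.ToType → Set ι := fun ξ => traceClosure A k {i | e i ≤ ξ}
  have hcl : Monotone cl := fun ξ η h => traceClosure_mono A k fun i hi => le_trans hi h
  have hcard : ∀ ξ, #(cl ξ) ≤ lam := by
    intro ξ
    have hS : #{i | e i ≤ ξ} ≤ lam := by
      have h1 : #(Set.Iic ξ) ≤ lam := by
        rw [← Set.Iio_insert]
        refine mk_insert_le.trans (add_le_of_le hl ?_ (one_le_aleph0.trans hl))
        exact Order.lt_succ_iff.1 (mk_Iio_lt_ord ξ)
      refine le_trans ?_ h1
      exact mk_le_of_injective (f := fun i : {i | e i ≤ ξ} => (⟨e i, i.2⟩ : Set.Iic ξ))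
        (fun a b hab => by simpa [Subtype.ext_iff] using hab)
    obtain ⟨T, hST, hT, hTc⟩ := exists_isTraceClosed A k hl hA had _ hS
    have hsub : cl ξ ⊆ T := Set.sInter_subset_of_mem ⟨hST, hTc⟩
    exact (mk_le_mk_of_subset hsub).trans hT
  have hne : ∀ i, {ξ | i ∈ cl ξ}.Nonempty := fun i =>
    ⟨e i, subset_traceClosure A k _ (le_refl (e i))⟩
  let r : ι → (Order.succ lam).ord.ToType := fun i =>
    (wellFounded_lt (α := (Order.succ lam).ord.ToType)).min {ξ | i ∈ cl ξ} (hne i)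
  have hr : ∀ i, i ∈ cl (r i) := fun i => WellFounded.min_mem _ _ (hne i)
  have hrle : ∀ i ξ, i ∈ cl ξ → r i ≤ ξ := fun i ξ h =>
    not_lt.1 (WellFounded.not_lt_min wellFounded_lt {ξ | i ∈ cl ξ} h)
  refine ⟨r, fun ξ => ?_, fun i E hE hx => ?_⟩
  · refine (mk_le_mk_of_subset ?_).trans (hcard ξ)
    rintro i rfl
    exact hr i
  · by_contra! hc
    obtain ⟨E', hE', hc'⟩ := Finset.exists_subset_card_eq (show k + 1 ≤ E.card from hc)
    have hx' : ∀ x ∈ E', ∃ j, r j < r i ∧ x ∈ A j := fun x h => hx x (hE' h)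
    have hne' : E'.Nonempty := Finset.card_pos.1 (by omega)
    have : Nonempty ι := ⟨i⟩
    -- Only finitely many ranks occur, so their maximum is still below `r i`; the closure at that
    -- stage already contains `i`, against the minimality of `r i`.
    choose! j hj hxj using hx'
    obtain ⟨x₀, hx₀, hmax⟩ := E'.exists_max_image (fun x => r (j x)) hne'
    have := isTraceClosed_traceClosure A k _ i E'
      ((Finset.coe_subset.2 hE').trans hE) hc'
      (fun x h => ⟨j x, hcl (hmax x h) (hr (j x)), hxj x h⟩)
    exact absurd (hj x₀ hx₀) (not_lt.2 (hrle i _ this))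

end Filtration

/-- A system of size `κ^{+m}` is ranked with ranks having `κ` members, so that each set has
at most `m * k` points in the sets of smaller rank. -/
theorem exists_rank_iterate {κ : Cardinal.{u}} (hκ : ℵ₀ ≤ κ) (k m : ℕ) :
    ∃ (R : Type u) (_ : LinearOrder R) (_ : WellFoundedLT R), ∀ (α ι : Type u) (A : ι → Set α),
      (∀ i, #(A i) ≤ κ) →
      (∀ i j, i ≠ j → ∀ E : Finset α, ↑E ⊆ A i → ↑E ⊆ A j → E.card ≤ k) →
      #ι ≤ Order.succ^[m] κ → ∃ r : ι → R, (∀ ξ, #{i | r i = ξ} ≤ κ) ∧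
        ∀ i, ∀ E : Finset α, ↑E ⊆ A i → (∀ x ∈ E, ∃ j, r j < r i ∧ x ∈ A j) →
          E.card ≤ m * k := by
  classical
  induction m with
  | zero =>
    refine ⟨PUnit, inferInstance, inferInstance, fun α ι A hA had hι => ⟨fun _ => PUnit.unit,
      fun ξ => (mk_set_le _).trans hι, fun i E hE hx => ?_⟩⟩
    have : E = ∅ := Finset.eq_empty_of_forall_notMem fun x h => by
      obtain ⟨j, hj, -⟩ := hx x h
      exact lt_irrefl _ hj
    simp [this]
  | succ m ih =>
    obtain ⟨R, _, _, hR⟩ := ih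
    obtain ⟨hκm, hm⟩ := aleph0_le_iterate_succ hκ m
    refine ⟨(Order.succ (Order.succ^[m] κ)).ord.ToType ×ₗ R, inferInstance, inferInstance,
      fun α ι A hA had hι => ?_⟩
    rw [Function.iterate_succ_apply'] at hι
    obtain ⟨r, hr, hrE⟩ := exists_rank_succ A k hm (fun i => (hA i).trans hκm) had hι
    have := fun ξ => hR α {i | r i = ξ} (fun i => A i) (fun i => hA i)
      (fun i j hij => had i j (fun h => hij (Subtype.ext h))) (hr ξ)
    choose s hs hsE using this
    refine ⟨fun i => toLex (r i, s (r i) ⟨i, rfl⟩), fun p => ?_, fun i E hE hx => ?_⟩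
    · obtain ⟨ξ, η⟩ := p
      refine le_trans ?_ (hs ξ η)
      have hmem : ∀ i ∈ {i | toLex (r i, s (r i) ⟨i, rfl⟩) = (ξ, η)}, r i = ξ :=
        fun i hi => congrArg Prod.fst hi
      refine mk_le_of_injective (f := fun i : {i | toLex (r i, s (r i) ⟨i, rfl⟩) = (ξ, η)} =>
        (⟨⟨i, hmem i i.2⟩, ?_⟩ : {i : {i | r i = ξ} | s ξ i = η})) ?_
      · obtain ⟨i, hi⟩ := i
        obtain rfl := hmem i hi
        exact congrArg Prod.snd hi
      · intro i j hij
        simpa [Subtype.ext_iff] using hij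
    · have h1 := hrE i (E.filter fun x => ∃ j, r j < r i ∧ x ∈ A j)
        ((Finset.coe_subset.2 (Finset.filter_subset _ _)).trans hE)
        (fun x h => (Finset.mem_filter.1 h).2)
      have h2 := hsE (r i) ⟨i, rfl⟩ (E.filter fun x => ¬ ∃ j, r j < r i ∧ x ∈ A j)
        ((Finset.coe_subset.2 (Finset.filter_subset _ _)).trans hE) (fun x h => by
          obtain ⟨hxE, hn⟩ := Finset.mem_filter.1 h
          obtain ⟨j, hj, hxj⟩ := hx x hxE
          rcases Prod.Lex.toLex_lt_toLex.1 hj with hj | ⟨hj, hj'⟩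
          · exact absurd ⟨j, hj, hxj⟩ hn
          · dsimp only at hj hj'
            refine ⟨⟨j, hj⟩, ?_, hxj⟩
            have : ∀ ξ (h : r j = ξ), s ξ ⟨j, h⟩ = s (r j) ⟨j, rfl⟩ := by
              rintro _ rfl; rfl
            rw [this]
            exact hj')
      have h3 := Finset.card_filter_add_card_filter_not (s := E) (fun x => ∃ j, r j < r i ∧ x ∈ A j)
      rw [← h3, add_mul, one_mul, add_comm]
      exact add_le_add h2 h1

/-! ### The greedy coloring and the upper bound -/

section Coloring

variable {α ι C R : Type u} [LinearOrder R]

/-- The color `c` is used on `A i` at an earlier stage of the partial assignment `g`, where stages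
are compared lexicographically by `r` and `e`. -/
def UsedBefore {W : Type u} [LinearOrder W] (A : ι → Set α) (r : ι → R) (e : ι → W)
    (g : ι → Option (α × C)) (i : ι) (c : C) : Prop :=
  ∃ x ∈ A i, ∃ j, toLex (r j, e j) < toLex (r i, e i) ∧ g j = some (x, c)

/-- More than `k` points of `A j` are assigned by `g` at stages of rank `r i` before `i`. -/
def FullBefore {W : Type u} [LinearOrder W] (A : ι → Set α) (r : ι → R) (e : ι → W) (k : ℕ)
    (g : ι → Option (α × C)) (i j : ι) : Prop :=
  ∃ E : Finset α, E.card = k + 1 ∧ ↑E ⊆ A j ∧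
    ∀ x ∈ E, ∃ j', r j' = r i ∧ e j' < e i ∧ ∃ c, g j' = some (x, c)

/-- The requirement on the value `v` at stage `i`: if every color is already used then nothing is
done, otherwise a fresh point is given an unused color. -/
def StageGood {W : Type u} [LinearOrder W] (A : ι → Set α) (r : ι → R) (e : ι → W) (k : ℕ)
    (i : ι) (g : ι → Option (α × C)) (v : Option (α × C)) : Prop :=
  (v = none ∧ ∀ c, UsedBefore A r e g i c) ∨
  ∃ x c, v = some (x, c) ∧ ¬ UsedBefore A r e g i c ∧ x ∈ A i ∧
    (∀ j, toLex (r j, e j) < toLex (r i, e i) → x ∉ A j) ∧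
    ∀ j, j ≠ i → r j = r i → FullBefore A r e k g i j → x ∉ A j

theorem StageGood.congr {W : Type u} [LinearOrder W] {A : ι → Set α} {r : ι → R} {e : ι → W}
    {k : ℕ} {i : ι} {g g' : ι → Option (α × C)} {v : Option (α × C)}
    (h : ∀ j, toLex (r j, e j) < toLex (r i, e i) → g j = g' j) (hv : StageGood A r e k i g v) :
    StageGood A r e k i g' v := by
  have hU : ∀ c, UsedBefore A r e g i c ↔ UsedBefore A r e g' i c := by
    intro c
    refine exists_congr fun x => and_congr_right fun _ => exists_congr fun j => ?_
    exact and_congr_right fun hj => by rw [h j hj]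
  have hF : ∀ j, FullBefore A r e k g i j ↔ FullBefore A r e k g' i j := by
    intro j
    refine exists_congr fun E => and_congr_right fun _ => and_congr_right fun _ =>
      forall₂_congr fun x _ => exists_congr fun j' => and_congr_right fun hr =>
      and_congr_right fun he => ?_
    rw [h j' (Prod.Lex.toLex_lt_toLex.2 (Or.inr ⟨hr, he⟩))]
  simpa only [StageGood, hU, hF] using hv

/-- The forbidden points number fewer than $\kappa$: finitely many come from smaller ranks (`B₁`),
and finitely many from each of fewer than $\kappa$ earlier sets of the same rank (`B₂`) and full
sets (`B₃`). -/
theorem exists_stageGood {κ : Cardinal.{u}} (hκ : ℵ₀ ≤ κ) (A : ι → Set α) (hA : ∀ i, #(A i) = κ)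
    (k N : ℕ) (had : ∀ i j, i ≠ j → ∀ E : Finset α, ↑E ⊆ A i → ↑E ⊆ A j → E.card ≤ k)
    (r : ι → R) (e : ι → κ.ord.ToType) (he : ∀ i j, r i = r j → e i = e j → i = j)
    (hr : ∀ i, ∀ E : Finset α, ↑E ⊆ A i → (∀ x ∈ E, ∃ j, r j < r i ∧ x ∈ A j) → E.card ≤ N)
    (i : ι) (g : ι → Option (α × C)) : ∃ v, StageGood A r e k i g v := by
  classical
  by_cases hU : ∀ c, UsedBefore A r e g i c
  · exact ⟨none, Or.inl ⟨rfl, hU⟩⟩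
  push Not at hU
  obtain ⟨c, hc⟩ := hU
  have hfin : ∀ j, j ≠ i → (A i ∩ A j).Finite := fun j hj =>
    finite_of_forall_card_le fun E hE => had i j hj.symm E
      (hE.trans Set.inter_subset_left) (hE.trans Set.inter_subset_right)
  let J : Set ι := {j | r j = r i ∧ e j < e i}
  have hJ : #J < κ := by
    refine lt_of_le_of_lt ?_ (mk_Iio_lt_ord (e i))
    refine mk_le_of_injective (f := fun j : J => (⟨e j, j.2.2⟩ : Set.Iio (e i))) ?_
    intro a b hab
    exact Subtype.ext (he a b (a.2.1.trans b.2.1.symm) (congrArg Subtype.val hab))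
  let B₁ : Set α := {x | x ∈ A i ∧ ∃ j, r j < r i ∧ x ∈ A j}
  have hB₁ : #B₁ < κ := by
    refine (lt_aleph0_iff_set_finite.2 ?_).trans_le hκ
    exact finite_of_forall_card_le fun E hE => hr i E (fun x hx => (hE hx).1) fun x hx => (hE hx).2
  let B₂ : Set α := ⋃ j ∈ J, A i ∩ A j
  have hB₂ : #B₂ < κ := mk_biUnion_finite_lt hκ J _ hJ fun j hj =>
    hfin j (by rintro rfl; exact lt_irrefl _ hj.2)
  let X : Set α := {x | ∃ j ∈ J, ∃ c, g j = some (x, c)}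
  have hX : #X < κ := by
    refine lt_of_le_of_lt ?_ hJ
    have hX' : ∀ x : X, ∃ j : J, ∃ c, g j = some (x.1, c) := fun x => by
      obtain ⟨j, hj, c, h⟩ := x.2
      exact ⟨⟨j, hj⟩, c, h⟩
    choose f c hf using hX'
    refine mk_le_of_injective (f := f) fun x y hxy => ?_
    have := (hf x).symm.trans (hxy ▸ hf y)
    simp only [Option.some.injEq, Prod.mk.injEq] at this
    exact Subtype.ext this.1
  let F : Set ι := {j | j ≠ i ∧ r j = r i ∧ FullBefore A r e k g i j}
  -- A full set is determined by $k+1$ of the fewer than $\kappa$ points assigned so far in this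
  -- rank.
  have hF : #F < κ := by
    refine lt_of_le_of_lt ?_ (mk_finset_lt hκ hX)
    have hF' : ∀ j : F, ∃ E : Finset X, E.card = k + 1 ∧ ↑(E.map (Function.Embedding.subtype _)) ⊆
        A j := by
      rintro ⟨j, -, -, E, hE, hEA, hx⟩
      have hmap : (E.subtype (· ∈ X)).map (Function.Embedding.subtype _) = E := by
        rw [Finset.subtype_map]
        refine Finset.filter_true_of_mem fun x hxE => ?_
        obtain ⟨j', h1, h2, c, h3⟩ := hx x hxE
        exact ⟨j', ⟨h1, h2⟩, c, h3⟩
      refine ⟨E.subtype (· ∈ X), ?_, ?_⟩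
      · rw [← hE, ← Finset.card_map (Function.Embedding.subtype _), hmap]
      · rw [hmap]; exact hEA
    choose f hf1 hf2 using hF'
    refine mk_le_of_injective (f := f) fun a b hab => ?_
    by_contra hne
    have h1 := had a b (fun h => hne (Subtype.ext h)) _ (hf2 a) (hab ▸ hf2 b)
    rw [Finset.card_map, hf1] at h1
    omega
  let B₃ : Set α := ⋃ j ∈ F, A i ∩ A j
  have hB₃ : #B₃ < κ := mk_biUnion_finite_lt hκ F _ hF fun j hj => hfin j hj.1
  have hB : #(B₁ ∪ (B₂ ∪ B₃) : Set α) < κ :=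
    (mk_union_le _ _).trans_lt (add_lt_of_lt hκ hB₁ ((mk_union_le _ _).trans_lt
      (add_lt_of_lt hκ hB₂ hB₃)))
  obtain ⟨x, hxA, hxB⟩ : ∃ x ∈ A i, x ∉ B₁ ∪ (B₂ ∪ B₃) := by
    by_contra! h
    exact absurd (mk_le_mk_of_subset h) (not_le.2 (by rwa [hA]))
  simp only [Set.mem_union, not_or] at hxB
  refine ⟨some (x, c), Or.inr ⟨x, c, rfl, hc, hxA, fun j hj hxj => ?_, fun j hj hrj hfull hxj =>
    hxB.2.2 (Set.mem_biUnion (x := j) ⟨hj, hrj, hfull⟩ ⟨hxA, hxj⟩)⟩⟩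
  rcases Prod.Lex.toLex_lt_toLex.1 hj with hj | hj
  · exact hxB.1 ⟨hxA, j, hj, hxj⟩
  · exact hxB.2.1 (Set.mem_biUnion (x := j) hj ⟨hxA, hxj⟩)

/-- At any stage a set contains at most `N + k + 1` points assigned earlier. -/
theorem card_le_of_stageGood {W : Type u} [LinearOrder W] (A : ι → Set α) (k N : ℕ)
    (r : ι → R) (e : ι → W) (he : ∀ i j, r i = r j → e i = e j → i = j)
    (hr : ∀ i, ∀ E : Finset α, ↑E ⊆ A i → (∀ x ∈ E, ∃ j, r j < r i ∧ x ∈ A j) → E.card ≤ N)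
    (g : ι → Option (α × C)) (hg : ∀ i, StageGood A r e k i g (g i)) (i : ι) (E : Finset α)
    (hE : ↑E ⊆ A i) (hx : ∀ x ∈ E, ∃ j c, toLex (r j, e j) < toLex (r i, e i) ∧
      g j = some (x, c)) : E.card ≤ N + (k + 1) := by
  classical
  have hmem : ∀ j x c, g j = some (x, c) → x ∈ A j := by
    intro j x c h
    rcases hg j with ⟨h', -⟩ | ⟨x', c', h', -, hx', -⟩
    · rw [h] at h'; cases h'
    · rw [h] at h'; cases h'; exact hx'
  rw [← Finset.card_filter_add_card_filter_not (s := E) (fun x => ∃ j, r j < r i ∧ x ∈ A j)]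
  refine add_le_add (hr i _ ((Finset.coe_subset.2 (Finset.filter_subset _ _)).trans hE)
    fun x h => (Finset.mem_filter.1 h).2) ?_
  set E₂ := E.filter fun x => ¬ ∃ j, r j < r i ∧ x ∈ A j
  have hE₂ : ∀ x ∈ E₂, x ∈ A i ∧ ∃ j c, r j = r i ∧ e j < e i ∧ g j = some (x, c) := by
    intro x h
    obtain ⟨hxE, hn⟩ := Finset.mem_filter.1 h
    obtain ⟨j, c, hj, hjx⟩ := hx x hxE
    rcases Prod.Lex.toLex_lt_toLex.1 hj with hj | ⟨hj, hj'⟩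
    · exact absurd ⟨j, hj, hmem j x c hjx⟩ hn
    · exact ⟨hE hxE, j, c, hj, hj', hjx⟩
  by_contra! hcard
  have hne : E₂.Nonempty := Finset.card_pos.1 (by omega)
  obtain ⟨x₁, hx₁⟩ := hne
  have : Nonempty ι := ⟨i⟩
  have : Nonempty C := ⟨(hE₂ x₁ hx₁).2.choose_spec.choose⟩
  have hE₂' : ∀ x, ∃ j c, x ∈ E₂ → x ∈ A i ∧ r j = r i ∧ e j < e i ∧ g j = some (x, c) := by
    intro x
    by_cases h : x ∈ E₂
    · obtain ⟨h1, j, c, h2⟩ := hE₂ x h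
      exact ⟨j, c, fun _ => ⟨h1, h2⟩⟩
    · exact ⟨i, Classical.arbitrary C, fun h' => absurd h' h⟩
  choose j c hj using hE₂'
  -- When the last of these points was assigned, the others had already made `A i` full, so that
  -- point should have avoided `A i`.
  obtain ⟨x₀, hx₀, hmax⟩ := E₂.exists_max_image (fun x => e (j x)) ⟨x₁, hx₁⟩
  obtain ⟨E', hE', hc'⟩ := Finset.exists_subset_card_eq (show k + 1 ≤ (E₂.erase x₀).card by
    rw [Finset.card_erase_of_mem hx₀]; omega)
  obtain ⟨hx₀A, hr₀, he₀, hg₀⟩ := hj x₀ hx₀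
  have hfull : FullBefore A r e k g (j x₀) i := by
    refine ⟨E', hc', fun x h => (hj x (Finset.mem_of_mem_erase (hE' h))).1, fun x h => ?_⟩
    have hxE := Finset.mem_of_mem_erase (hE' h)
    obtain ⟨-, h1, h2, h3⟩ := hj x hxE
    refine ⟨j x, h1.trans hr₀.symm, lt_of_le_of_ne (hmax x hxE) fun heq => ?_, c x, h3⟩
    have := he _ _ (h1.trans hr₀.symm) heq
    rw [this, hg₀] at h3
    simp only [Option.some.injEq, Prod.mk.injEq] at h3
    exact Finset.ne_of_mem_erase (hE' h) h3.1.symm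
  rcases hg (j x₀) with ⟨h', -⟩ | ⟨x', c', h', -, -, -, havoid⟩
  · rw [hg₀] at h'; cases h'
  · rw [hg₀] at h'; cases h'
    exact havoid i (by intro h; rw [← h] at he₀; exact lt_irrefl _ he₀) hr₀.symm hfull hx₀A

end Coloring

/-- A `(κ^{+m}, κ, k + 1)`-system has a weak conflict free coloring with any finite set `C` of
colors such that `m * k + k + 1 < 2 * |C|`. -/
theorem exists_isWeakCFColoring {α C : Type u} [Fintype C] {κ : Cardinal.{u}} (hκ : ℵ₀ ≤ κ)
    (k m : ℕ) (hC : m * k + (k + 1) < 2 * Fintype.card C) (𝒜 : Set (Set α))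
    (h𝒜 : IsSystem 𝒜 (Order.succ^[m] κ) κ ((k + 1 : ℕ) : Cardinal.{u})) :
    ∃ f : α → Option C, IsWeakCFColoring 𝒜 f := by
  classical
  let A : 𝒜 → Set α := fun i => i
  have hA : ∀ i, #(A i) = κ := fun i => h𝒜.card_mem i i.2
  have had : ∀ i j, i ≠ j → ∀ E : Finset α, ↑E ⊆ A i → ↑E ⊆ A j → E.card ≤ k := by
    intro i j hij E hi hj
    have h1 := h𝒜.almostDisjoint i i.2 j j.2 (fun h => hij (Subtype.ext h))
    have h2 : #(E : Set α) ≤ #(↑i ∩ ↑j : Set α) := mk_le_mk_of_subset (Set.subset_inter hi hj)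
    have h3 := h2.trans_lt h1
    rw [Finset.coe_sort_coe, mk_coe_finset] at h3
    have : E.card < k + 1 := by exact_mod_cast h3
    omega
  obtain ⟨R, _, _, hR⟩ := exists_rank_iterate hκ k m
  obtain ⟨r, hrκ, hr⟩ := hR α 𝒜 A (fun i => (hA i).le) had h𝒜.card_system.le
  have hemb : ∀ ξ, Nonempty ({i | r i = ξ} ↪ κ.ord.ToType) := fun ξ => by
    rw [← le_def]; simpa using hrκ ξ
  let e : 𝒜 → κ.ord.ToType := fun i => (hemb (r i)).some ⟨i, rfl⟩
  have he : ∀ i j, r i = r j → e i = e j → i = j := by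
    intro i j hij h
    have : ∀ ξ (h : r j = ξ), (hemb ξ).some ⟨j, h⟩ = e j := by rintro _ rfl; rfl
    rw [← this (r i) hij.symm] at h
    exact congrArg Subtype.val ((hemb (r i)).some.injective h)
  let q : 𝒜 → R ×ₗ κ.ord.ToType := fun i => toLex (r i, e i)
  have hq : Function.Injective q := fun i j h =>
    he i j (congrArg Prod.fst h) (congrArg Prod.snd h)
  obtain ⟨g, hg⟩ := exists_wellFounded_choice (r := InvImage (· < ·) q)
    (InvImage.wf q wellFounded_lt) (fun i g v => StageGood (C := C) A r e k i g v)
    (fun i g g' h v hv => hv.congr h)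
    (fun i g => exists_stageGood hκ A hA k (m * k) had r e he hr i g)
  have hsome : ∀ i x c, g i = some (x, c) → ¬ UsedBefore A r e g i c ∧ x ∈ A i ∧
      ∀ j, q j < q i → x ∉ A j := by
    intro i x c h
    rcases hg i with ⟨h', -⟩ | ⟨x', c', h', h1, h2, h3, -⟩
    · rw [h] at h'; cases h'
    · rw [h] at h'; cases h'; exact ⟨h1, h2, h3⟩
  have huniq : ∀ i j x c c', g i = some (x, c) → g j = some (x, c') → i = j := by
    intro i j x c c' hi hj
    by_contra hne
    rcases lt_or_gt_of_ne (hq.ne hne) with h | h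
    · exact (hsome j x c' hj).2.2 i h (hsome i x c hi).2.1
    · exact (hsome i x c hi).2.2 j h (hsome j x c' hj).2.1
  let f : α → Option C := fun x =>
    if h : ∃ c i, g i = some (x, c) then some h.choose else none
  have hf : ∀ x c, f x = some c ↔ ∃ i, g i = some (x, c) := by
    intro x c
    constructor
    · intro h
      by_cases hx : ∃ c i, g i = some (x, c)
      · simp only [f, dif_pos hx, Option.some.injEq] at h
        rw [← h]; exact hx.choose_spec
      · rw [show f x = none from dif_neg hx] at h
        cases h
    · rintro ⟨i, hi⟩
      have hx : ∃ c i, g i = some (x, c) := ⟨c, i, hi⟩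
      simp only [f, dif_pos hx, Option.some.injEq]
      obtain ⟨j, hj⟩ := hx.choose_spec
      obtain rfl := huniq i j x _ _ hi hj
      rw [hi] at hj
      simp only [Option.some.injEq, Prod.mk.injEq] at hj
      exact hj.2.symm
  refine ⟨f, fun x hx => ?_, fun S hS => ?_⟩
  · obtain ⟨c, hc⟩ := Option.ne_none_iff_exists'.1 hx
    obtain ⟨i, hi⟩ := (hf x c).1 hc
    exact ⟨i, i.2, (hsome i x c hi).2.1⟩
  obtain ⟨i, rfl⟩ : ∃ i : 𝒜, S = A i := ⟨⟨S, hS⟩, rfl⟩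
  have hlt : ∀ y ∈ A i, ∀ c j, g j = some (y, c) → j ≠ i → q j < q i := by
    intro y hy c j hj hne
    rcases lt_or_gt_of_ne (hq.ne hne) with h | h
    · exact h
    · exact absurd hy ((hsome j y c hj).2.2 i h)
  rcases hg i with ⟨hnone, hall⟩ | ⟨x, c, hx, hc, hxA, -⟩
  · by_contra! hcon
    have hpair : ∀ c, ∃ p : Bool → α, Function.Injective p ∧ ∀ b, p b ∈ A i ∧ f (p b) = some c := by
      intro c
      obtain ⟨x, hxA, j, -, hj⟩ := hall c
      have hfx := (hf x c).2 ⟨j, hj⟩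
      obtain ⟨y, hyA, hfy, hyx⟩ : ∃ y ∈ A i, f y = some c ∧ y ≠ x := by
        by_contra! h
        refine hcon c ?_
        have : A i ∩ f ⁻¹' {some c} = {x} := by
          ext y
          constructor
          · exact fun hy => h y hy.1 hy.2
          · rintro rfl; exact ⟨hxA, hfx⟩
        rw [this, mk_singleton]
      refine ⟨fun b => if b then x else y, ?_, ?_⟩
      · intro a b
        cases a <;> cases b <;> simp [hyx, hyx.symm]
      · intro b
        cases b <;> simp [*]
    choose p hpi hp using hpair
    have hinj : Function.Injective fun z : C × Bool => p z.1 z.2 := by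
      rintro ⟨c, b⟩ ⟨c', b'⟩ h
      dsimp only at h
      have hcc : c = c' := by
        have h1 := (hp c b).2
        rw [h, (hp c' b').2] at h1
        exact (Option.some.inj h1).symm
      subst hcc
      rw [hpi c h]
    have hcard := card_le_of_stageGood A k (m * k) r e he hr g hg i
      (Finset.univ.image fun z : C × Bool => p z.1 z.2) (by
        intro x hx
        obtain ⟨z, -, rfl⟩ := Finset.mem_image.1 hx
        exact (hp z.1 z.2).1) (by
        intro x hx
        obtain ⟨z, -, rfl⟩ := Finset.mem_image.1 hx
        obtain ⟨j, hj⟩ := (hf _ _).1 (hp z.1 z.2).2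
        refine ⟨j, z.1, hlt _ (hp z.1 z.2).1 z.1 j hj ?_, hj⟩
        rintro rfl
        rw [hnone] at hj; cases hj)
    rw [Finset.card_image_of_injective _ hinj, Finset.card_univ, Fintype.card_prod,
      Fintype.card_bool] at hcard
    omega
  · refine ⟨c, ?_⟩
    have : A i ∩ f ⁻¹' {some c} = {x} := by
      ext y
      constructor
      · rintro ⟨hyA, hfy⟩
        obtain ⟨j, hj⟩ := (hf y c).1 hfy
        by_cases hji : j = i
        · subst hji
          rw [hx] at hj
          simp only [Option.some.injEq, Prod.mk.injEq] at hj
          exact hj.1.symm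
        · exact absurd ⟨y, hyA, j, hlt y hyA c j hj hji, hj⟩ hc
      · rintro rfl
        exact ⟨hxA, (hf y c).2 ⟨i, hx⟩⟩
    rw [this, mk_singleton]

/-! ### Guessing families -/

/-- A family of `lam` sets of size `κ` with pairwise intersections of size at most `2 * l`, indexed
by a labelled type. Given a coloring with finitely many colors and finitely many labels, there is a
set `D` of colors such that, for all `P ⊆ D` with at most `n * l` elements, each of these labels
has a set of the family which only has colors from `D`, and each color from `P` at least twice. -/
structure GuessingFamily (lam κ : Cardinal.{u}) (n l : ℕ) where
  /-- the ground set -/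
  V : Type u
  /-- the index type -/
  J : Type u
  /-- the labels -/
  L : Type u
  /-- the members of the family -/
  A : J → Set V
  /-- the label of an index -/
  lab : J → L
  nonempty : Nonempty V
  card_ground : #V ≤ lam
  card_index : #J ≤ lam
  card_label : #L = lam
  card_mem : ∀ j, #(A j) = κ
  inter : ∀ i j, i ≠ j → ∃ E : Finset V, A i ∩ A j ⊆ E ∧ E.card ≤ 2 * l
  guess : ∀ (C : Type u) [Finite C] (f : V → Option C) (Λ : Finset L), ∃ D : Finset C,
    ∀ P ⊆ D, P.card ≤ n * l → ∀ a ∈ Λ, ∃ j, lab j = a ∧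
      (∀ v ∈ A j, ∀ c, f v = some c → c ∈ D) ∧
      ∀ c ∈ P, ∃ x ∈ A j, ∃ y ∈ A j, x ≠ y ∧ f x = some c ∧ f y = some c

/-! ### The base case: a free family of size `κ` -/

section Base

/-- The arity of a node of `FreePoint`. -/
abbrev freeArity (k : ℕ) (T : Type u) (a : Fin (k + 1) × (T × T) × T) : Type := Fin a.1

/-- The points freely generated by the operations adding, for each family of at most `k` points,
new points indexed by a label, a copy number and a serial number from `T`. -/
abbrev FreePoint (k : ℕ) (T : Type u) : Type u := WType (freeArity k T)

/-- Indices of the sets of the free family: families of at most `k` points with a label and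
a copy number. -/
abbrev FreeIndex (k : ℕ) (T : Type u) : Type u :=
  Σ n : Fin (k + 1), (Fin n → FreePoint k T) × T × T

/-- The new points generated by an index. -/
def newPoint {k : ℕ} {T : Type u} (j : FreeIndex k T) (t : T) : FreePoint k T :=
  WType.mk (j.1, j.2.2, t) j.2.1

theorem newPoint_inj {k : ℕ} {T : Type u} {i j : FreeIndex k T} {s t : T}
    (h : newPoint i s = newPoint j t) : i = j ∧ s = t := by
  obtain ⟨n, F, a⟩ := i
  obtain ⟨n', F', a'⟩ := j
  simp only [newPoint, WType.mk.injEq, Prod.mk.injEq] at h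
  obtain ⟨⟨rfl, rfl, rfl⟩, h⟩ := h
  obtain rfl := eq_of_heq h
  exact ⟨rfl, rfl⟩

/-- The set with a given index: the given points together with the new ones. -/
def freeSet {k : ℕ} {T : Type u} (j : FreeIndex k T) : Set (FreePoint k T) :=
  Set.range j.2.1 ∪ Set.range (newPoint j)

/-- A new point has larger depth than its generators, so two indices cannot each have a new point
among the generators of the other; new points of different indices are distinct. -/
theorem freeSet_inter {k : ℕ} {T : Type u} {i j : FreeIndex k T} (hij : i ≠ j) :
    freeSet i ∩ freeSet j ⊆ Set.range i.2.1 ∨ freeSet i ∩ freeSet j ⊆ Set.range j.2.1 := by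
  by_cases h : ∃ s, newPoint i s ∈ Set.range j.2.1
  · right
    rintro x ⟨hx, hxj | ⟨t, rfl⟩⟩
    · exact hxj
    obtain ⟨s, q, hs⟩ := h
    rcases hx with ⟨p, hp⟩ | ⟨s', hs'⟩
    · have h1 : (newPoint i s).depth < (newPoint j t).depth := by
        rw [← hs]; exact WType.depth_lt_depth_mk (β := freeArity k T) (j.1, j.2.2, t) j.2.1 q
      have h2 : (newPoint j t).depth < (newPoint i s).depth := by
        rw [← hp]; exact WType.depth_lt_depth_mk (β := freeArity k T) (i.1, i.2.2, s) i.2.1 p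
      exact absurd h1 h2.asymm
    · exact absurd (newPoint_inj hs').1 hij
  · left
    rintro x ⟨hx | ⟨s, rfl⟩, hxj⟩
    · exact hx
    rcases hxj with hxj | ⟨t, ht⟩
    · exact absurd ⟨s, hxj⟩ h
    · exact absurd (newPoint_inj ht).1.symm hij

theorem mk_freePoint_le {k : ℕ} {T : Type u} [Infinite T] : #(FreePoint k T) ≤ #T := by
  have hT : ℵ₀ ≤ #T := aleph0_le_mk T
  refine WType.cardinalMk_le_max_aleph0_of_finite'.trans (max_le ?_ hT)
  simp only [mk_prod, lift_id, lift_id', mk_fin, lift_natCast, mul_eq_self hT]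
  exact mul_le_of_le hT (natCast_lt_aleph0.le.trans hT) le_rfl

theorem exists_guessingFamily_base {κ : Cardinal.{u}} (hκ : ℵ₀ ≤ κ) (l : ℕ) :
    Nonempty (GuessingFamily κ κ 1 l) := by
  classical
  induction κ using Cardinal.inductionOn with | _ T
  have hT : Infinite T := aleph0_le_mk_iff.1 hκ
  obtain ⟨t₀⟩ : Nonempty T := inferInstance
  refine ⟨⟨FreePoint (2 * l) T, FreeIndex (2 * l) T, T, freeSet, fun j => j.2.2.1, ?_,
    mk_freePoint_le, ?_, rfl, fun j => ?_, fun i j hij => ?_, fun C _ f Λ => ?_⟩⟩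
  · exact ⟨newPoint ⟨0, Fin.elim0, t₀, t₀⟩ t₀⟩
  · exact (mk_le_of_injective (f := fun j : FreeIndex (2 * l) T => newPoint j t₀)
      fun i j h => (newPoint_inj h).1).trans mk_freePoint_le
  · refine le_antisymm ((mk_set_le _).trans mk_freePoint_le) ?_
    exact mk_le_of_injective (f := fun t => (⟨newPoint j t, Or.inr ⟨t, rfl⟩⟩ : freeSet j))
      fun s t h => (newPoint_inj (congrArg Subtype.val h)).2
  · have hcard : ∀ i : FreeIndex (2 * l) T, (Finset.univ.image i.2.1).card ≤ 2 * l := fun i => by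
      refine Finset.card_image_le.trans ?_
      have := i.1.2
      simp only [Finset.card_univ, Fintype.card_fin]
      omega
    rcases freeSet_inter hij with h | h
    · exact ⟨Finset.univ.image i.2.1, by simpa using h, hcard i⟩
    · exact ⟨Finset.univ.image j.2.1, by simpa using h, hcard j⟩
  · have := Fintype.ofFinite C
    -- `D` consists of the colors occurring at least twice.
    refine ⟨Finset.univ.filter fun c => ∃ x y, x ≠ y ∧ f x = some c ∧ f y = some c,
      fun P hP hPc a _ => ?_⟩
    have hxy : ∀ c ∈ P, ∃ x y, x ≠ y ∧ f x = some c ∧ f y = some c := fun c hc =>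
      (Finset.mem_filter.1 (hP hc)).2
    have : Nonempty (FreePoint (2 * l) T) := ⟨newPoint ⟨0, Fin.elim0, t₀, t₀⟩ t₀⟩
    choose! x y hxy using hxy
    let E : Finset (FreePoint (2 * l) T) := P.biUnion fun c => {x c, y c}
    have hE : E.card < 2 * l + 1 := by
      have := Finset.card_biUnion_le_card_mul P (fun c => ({x c, y c} : Finset _)) 2
        fun c _ => Finset.card_le_two
      change E.card ≤ _ at this
      omega
    let idx : T → FreeIndex (2 * l) T := fun t => ⟨⟨E.card, hE⟩, fun p => E.equivFin.symm p, a, t⟩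
    have hrange : ∀ t, Set.range (idx t).2.1 = E := by
      intro t
      ext v
      constructor
      · rintro ⟨p, rfl⟩
        exact (E.equivFin.symm p).2
      · intro hv
        exact ⟨E.equivFin ⟨v, hv⟩, by simp [idx]⟩
    have hEmem : ∀ t, ∀ v ∈ E, v ∈ freeSet (idx t) := fun t v hv => Or.inl (by
      rw [hrange]; exact hv)
    -- Some copy has no new point with a color outside `D`: otherwise, among infinitely many copies,
    -- two would produce the same such color at different points.
    obtain ⟨t, ht⟩ : ∃ t, ∀ s c, f (newPoint (idx t) s) = some c →
        ∃ x y, x ≠ y ∧ f x = some c ∧ f y = some c := by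
      by_contra! h
      choose s c h1 h2 using h
      refine not_injective_infinite_finite c fun t t' htt => ?_
      by_contra hne
      refine h2 t (newPoint (idx t) (s t)) (newPoint (idx t') (s t')) ?_ (h1 t) ?_
      · intro h
        have := (newPoint_inj h).1
        simp only [idx, Sigma.mk.injEq, heq_eq_eq, Prod.mk.injEq, true_and] at this
        exact hne this
      · rw [htt]; exact h1 t'
    refine ⟨idx t, rfl, ?_, fun c hc => ?_⟩
    · rintro v (hv | ⟨s, rfl⟩) c hfc
      · rw [hrange] at hv
        obtain ⟨c', hc', hv⟩ := Finset.mem_biUnion.1 hv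
        have hfv : f v = some c' := by
          rcases Finset.mem_insert.1 hv with rfl | hv
          · exact (hxy c' hc').2.1
          · rw [Finset.mem_singleton.1 hv]; exact (hxy c' hc').2.2
        rw [hfv] at hfc
        cases hfc
        exact hP hc'
      · exact Finset.mem_filter.2 ⟨Finset.mem_univ _, ht s c hfc⟩
    · refine ⟨x c, hEmem t _ (Finset.mem_biUnion.2 ⟨c, hc, by simp⟩), y c,
        hEmem t _ (Finset.mem_biUnion.2 ⟨c, hc, by simp⟩), hxy c hc⟩

end Base

/-! ### The successor step -/

/-- The pairwise disjoint families of small finite sets below `ξ`. -/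
def IsGuessBelow {W V I : Type u} [LinearOrder W] (l : ℕ) (ξ : W) (h : I → Finset (W × V)) : Prop :=
  (∀ s t, s ≠ t → Disjoint (h s) (h t)) ∧ ∀ s, (h s).card ≤ 2 * l ∧ ∀ p ∈ h s, p.1 < ξ

/-- Each `ξ` has at most `lam` predecessors, so the labels can list everything coded below `ξ`. -/
theorem exists_cover_Iio {lam : Cardinal.{u}} {L X : Type u} (hL : #L = lam)
    (hX : #X ≤ Order.succ lam) (x₀ : X) :
    ∃ (cd : X → (Order.succ lam).ord.ToType) (π : (Order.succ lam).ord.ToType → L → X),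
      ∀ ξ x, cd x < ξ → ∃ a, π ξ a = x := by
  classical
  obtain ⟨cd⟩ : Nonempty (X ↪ (Order.succ lam).ord.ToType) := by
    rw [← le_def]; simpa using hX
  have h : ∀ ξ, ∃ p : L → X, ∀ x, cd x < ξ → ∃ a, p a = x := by
    intro ξ
    have h1 : #{x | cd x < ξ} ≤ #L := by
      rw [hL]
      refine le_trans ?_ (Order.lt_succ_iff.1 (mk_Iio_lt_ord ξ))
      exact mk_le_of_injective (f := fun x : {x | cd x < ξ} => (⟨cd x, x.2⟩ : Set.Iio ξ))
        (fun a b hab => by simpa [Subtype.ext_iff] using hab)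
    obtain ⟨q⟩ := (le_def _ _).1 h1
    have : Nonempty X := ⟨x₀⟩
    refine ⟨fun a => if h : ∃ y, q y = a then (h.choose : X) else x₀, fun x hx => ⟨q ⟨x, hx⟩, ?_⟩⟩
    have h : ∃ y, q y = q ⟨x, hx⟩ := ⟨_, rfl⟩
    change (if h : ∃ y, q y = q ⟨x, hx⟩ then (h.choose : X) else x₀) = x
    rw [dif_pos h, q.injective h.choose_spec]
  choose π hπ using h
  exact ⟨cd, π, hπ⟩

/-- Disjoint pairs of points of each color in a set of frequent colors. -/
theorem exists_pairs {I V C : Type u} [Infinite I] (f : V → Option C) (c : C)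
    (hc : #I < #{v | f v = some c}) :
    ∃ p : I → Bool → V, (∀ i b i' b', p i b = p i' b' → i = i' ∧ b = b') ∧
      ∀ i b, f (p i b) = some c := by
  have hI : ℵ₀ ≤ #I := aleph0_le_mk I
  have h1 : #(I × ULift.{u} Bool) ≤ #{v | f v = some c} := by
    refine le_trans ?_ hc.le
    rw [mk_prod, lift_id, lift_id]
    exact mul_le_of_le hI le_rfl ((lt_aleph0_of_finite _).le.trans hI)
  obtain ⟨q⟩ := (le_def _ _).1 h1
  refine ⟨fun i b => q (i, ULift.up b), fun i b i' b' h => ?_, fun i b => (q _).2⟩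
  have := q.injective (Subtype.ext h)
  simpa using this

theorem exists_guessingFamily_succ {lam κ : Cardinal.{u}} (hκ : ℵ₀ ≤ κ) (hlam : κ ≤ lam)
    (hpow : (2 : Cardinal.{u}) ^ lam = Order.succ lam) {n l : ℕ} (G : GuessingFamily lam κ n l) :
    Nonempty (GuessingFamily (Order.succ lam) κ (n + 1) l) := by
  classical
  have hl : ℵ₀ ≤ lam := hκ.trans hlam
  have hls : lam ≤ Order.succ lam := Order.le_succ lam
  have hl' : ℵ₀ ≤ Order.succ lam := hl.trans hls
  obtain ⟨V, J, L, A, lab, ⟨v₀⟩, hV, hJ, hL, hA, hinter, hguess⟩ := G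
  let W := (Order.succ lam).ord.ToType
  have hW : #W = Order.succ lam := by simp [W]
  have hLinf : Infinite L := aleph0_le_mk_iff.1 (hl.trans hL.ge)
  have hWinf : Infinite W := aleph0_le_mk_iff.1 (hl'.trans hW.ge)
  have hWV : #(W × V) ≤ Order.succ lam := by
    rw [mk_prod, lift_id, lift_id, hW]
    exact mul_le_of_le hl' le_rfl (hV.trans hls)
  -- This is where GCH enters: $(\lambda^+)^\lambda=2^\lambda=\lambda^+$.
  have hH : #((L → Finset (W × V)) × W) ≤ Order.succ lam := by
    rw [mk_prod, lift_id, lift_id, hW]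
    refine mul_le_of_le hl' ?_ le_rfl
    rw [← power_def, hL, ← hpow]
    refine (power_le_power_right (mk_finset_le hl' hWV)).trans ?_
    rw [← hpow, ← power_mul, mul_eq_self hl]
  obtain ⟨w₀⟩ : Nonempty W := inferInstance
  obtain ⟨cd, π, hπ⟩ := exists_cover_Iio hL hH ((fun _ => ∅), w₀)
  -- The label of `j` picks a candidate family below `ξ`; unsuitable candidates are replaced by
  -- empty sets, which keep the intersections small.
  let hh : W → J → L → Finset (W × V) := fun ξ j =>
    if IsGuessBelow l ξ (π ξ (lab j)).1 then (π ξ (lab j)).1 else fun _ => ∅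
  have hhd : ∀ ξ, IsGuessBelow l ξ (fun _ : L => (∅ : Finset (W × V))) := fun ξ =>
    ⟨fun s t _ => by simp, fun s => by simp⟩
  have hhg : ∀ ξ j, IsGuessBelow l ξ (hh ξ j) := by
    intro ξ j
    by_cases h : IsGuessBelow l ξ (π ξ (lab j)).1
    · simpa only [hh, if_pos h] using h
    · simpa only [hh, if_neg h] using hhd ξ
  have hs := fun ξ => exists_disjoint_choice (J := J) (I := L) (hJ.trans hL.ge) (hh ξ)
    fun j => (hhg ξ j).1
  choose s hs using hs
  let A' : W × J → Set (W × V) := fun p =>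
    Prod.mk p.1 '' A p.2 ∪ (hh p.1 p.2 (s p.1 p.2) : Set (W × V))
  have hbelow : ∀ ξ j, ∀ p ∈ hh ξ j (s ξ j), p.1 < ξ := fun ξ j => ((hhg ξ j).2 _).2
  have hinter_lt : ∀ p q : W × J, p.1 < q.1 → A' p ∩ A' q ⊆ (hh q.1 q.2 (s q.1 q.2) : Set _) := by
    rintro p q hpq x ⟨hx, ⟨v, -, rfl⟩ | hx'⟩
    · rcases hx with ⟨v', -, hv⟩ | hx
      · exact absurd (congrArg Prod.fst hv) hpq.ne
      · exact absurd (hbelow _ _ _ hx) hpq.not_gt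
    · exact hx'
  refine ⟨⟨W × V, W × J, W, A', fun p => (π p.1 (lab p.2)).2, ⟨(w₀, v₀)⟩, hWV, ?_, hW,
    fun p => ?_, fun p q hpq => ?_, fun C _ f Λ => ?_⟩⟩
  · rw [mk_prod, lift_id, lift_id, hW]
    exact mul_le_of_le hl' le_rfl (hJ.trans hls)
  · have him : #(Prod.mk p.1 '' A p.2 : Set (W × V)) = κ := by
      rw [mk_image_eq (Prod.mk_right_injective p.1), hA]
    refine le_antisymm ((mk_union_le _ _).trans (add_le_of_le hκ him.le ?_)) ?_
    · exact (lt_aleph0_iff_set_finite.2 (Finset.finite_toSet _)).le.trans hκ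
    · rw [← him]; exact mk_le_mk_of_subset Set.subset_union_left
  · rcases lt_trichotomy p.1 q.1 with h | h | h
    · exact ⟨_, hinter_lt p q h, ((hhg _ _).2 _).1⟩
    · obtain ⟨ξ, i⟩ := p
      obtain ⟨ξ', j⟩ := q
      obtain rfl : ξ = ξ' := h
      have hij : i ≠ j := fun h => hpq (by rw [h])
      obtain ⟨E, hE, hEc⟩ := hinter i j hij
      refine ⟨E.image (Prod.mk ξ), ?_, Finset.card_image_le.trans hEc⟩
      rintro x ⟨⟨v, hv, rfl⟩ | hx, ⟨v', hv', hvv⟩ | hx'⟩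
      · obtain rfl : v' = v := congrArg Prod.snd hvv
        exact Finset.mem_coe.2 (Finset.mem_image_of_mem _ (hE ⟨hv, hv'⟩))
      · exact absurd (hbelow _ _ _ hx') (lt_irrefl _)
      · rw [← hvv] at hx
        exact absurd (hbelow _ _ _ hx) (lt_irrefl _)
      · exact absurd hx' (Finset.disjoint_left.1 (hs ξ i j hij) hx)
    · exact ⟨_, by rw [Set.inter_comm]; exact hinter_lt q p h, ((hhg _ _).2 _).1⟩
  · have := Fintype.ofFinite C
    -- Colors outside `B` occupy at most `lam` points, hence vanish from some level on; a color in
    -- `B` admits `lam` disjoint pairs.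
    let B : Set C := {c | #L < #{v | f v = some c}}
    have hp : ∀ c : C, ∃ p : L → Bool → W × V, c ∈ B →
        (∀ i b i' b', p i b = p i' b' → i = i' ∧ b = b') ∧ ∀ i b, f (p i b) = some c := by
      intro c
      by_cases hc : c ∈ B
      · obtain ⟨p, hp⟩ := exists_pairs f c hc
        exact ⟨p, fun _ => hp⟩
      · exact ⟨fun _ _ => (w₀, v₀), fun h => absurd h hc⟩
    choose p hp using hp
    let gs : Finset C → L → Finset (W × V) := fun S i => S.biUnion fun c => {p c i true, p c i false}
    have hgs : ∀ S i v, v ∈ gs S i ↔ ∃ c ∈ S, ∃ b, v = p c i b := by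
      intro S i v
      simp only [gs, Finset.mem_biUnion, Finset.mem_insert, Finset.mem_singleton, Bool.exists_bool]
      exact exists_congr fun c => and_congr_right fun _ => or_comm
    obtain ⟨ξ, hξ⟩ : ∃ ξ : W, (∀ v c, c ∉ B → f v = some c → v.1 < ξ) ∧
        (∀ c i b, (p c i b).1 < ξ) ∧ ∀ S, ∀ a ∈ Λ, cd (gs S, a) < ξ := by
      have h1 : #(⋃ c ∈ Bᶜ, {v | f v = some c} : Set (W × V)) ≤ lam := by
        refine mk_biUnion_le_of_le hl _ _ ((lt_aleph0_of_finite _).le.trans hl) fun c hc => ?_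
        rw [← hL]
        exact not_lt.1 hc
      have h2 : #(Set.range fun z : C × L × ULift.{u} Bool => (p z.1 z.2.1 z.2.2.down).1) ≤ lam := by
        refine mk_range_le.trans ?_
        simp only [mk_prod, lift_id, hL]
        exact mul_le_of_le hl ((lt_aleph0_of_finite _).le.trans hl)
          (mul_le_of_le hl le_rfl ((lt_aleph0_of_finite _).le.trans hl))
      have h3 : (Set.range fun z : Finset C × Λ => cd (gs z.1, z.2)).Finite := Set.finite_range _
      obtain ⟨ξ, hξ⟩ := exists_forall_lt_of_mk_le hl
        (Prod.fst '' (⋃ c ∈ Bᶜ, {v | f v = some c} : Set (W × V)) ∪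
          ((Set.range fun z : C × L × ULift.{u} Bool => (p z.1 z.2.1 z.2.2.down).1) ∪
          Set.range fun z : Finset C × Λ => cd (gs z.1, z.2)))
        ((mk_union_le _ _).trans (add_le_of_le hl (mk_image_le.trans h1)
          ((mk_union_le _ _).trans (add_le_of_le hl h2
            ((lt_aleph0_iff_set_finite.2 h3).le.trans hl)))))
      refine ⟨ξ, fun v c hc hv => hξ _ (Or.inl ⟨v, Set.mem_biUnion (x := c) hc hv, rfl⟩),
        fun c i b => hξ _ (Or.inr (Or.inl ⟨(c, i, ULift.up b), rfl⟩)),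
        fun S a ha => hξ _ (Or.inr (Or.inr ⟨(S, ⟨a, ha⟩), rfl⟩))⟩
    obtain ⟨hsmall, hpξ, hcd⟩ := hξ
    have hq : ∀ z : Finset C × Λ, ∃ a, π ξ a = (gs z.1, z.2.1) := fun z =>
      hπ ξ _ (hcd z.1 z.2 z.2.2)
    -- `q` gives, for each possible remainder of colors and each required new label, an old label
    -- coding both. These are finitely many, so one `D` works for all.
    choose q hq using hq
    obtain ⟨D, hD⟩ := hguess C (fun v => f (ξ, v)) (Finset.univ.image q)
    refine ⟨D.filter (· ∈ B), fun P hP hPc a ha => ?_⟩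
    -- The old set in level `ξ` takes care of up to $n\ell$ colors; the at most $\ell$ others are
    -- doubled by the added pairs.
    obtain ⟨P₁, hP₁, hP₁c⟩ := Finset.exists_subset_card_eq (min_le_right (n * l) P.card)
    have hS : (P \ P₁).card ≤ l := by
      rw [Finset.card_sdiff_of_subset hP₁, hP₁c]
      rw [add_mul, one_mul] at hPc
      omega
    have hPB : ∀ c ∈ P, c ∈ D ∧ c ∈ B := fun c hc => Finset.mem_filter.1 (hP hc)
    have hguessS : IsGuessBelow l ξ (gs (P \ P₁)) := by
      have hSB : ∀ c ∈ P \ P₁, c ∈ B := fun c hc => (hPB c (Finset.mem_sdiff.1 hc).1).2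
      refine ⟨fun i j hij => Finset.disjoint_left.2 fun v hv hv' => ?_, fun i => ⟨?_, fun v hv => ?_⟩⟩
      · obtain ⟨c, hc, b, rfl⟩ := (hgs _ _ _).1 hv
        obtain ⟨c', hc', b', h⟩ := (hgs _ _ _).1 hv'
        have h1 := (hp c (hSB c hc)).2 i b
        rw [h, (hp c' (hSB c' hc')).2 j b'] at h1
        obtain rfl := Option.some.inj h1
        exact hij ((hp c' (hSB c' hc)).1 _ _ _ _ h).1
      · have := Finset.card_biUnion_le_card_mul (P \ P₁)
          (fun c => ({p c i true, p c i false} : Finset _)) 2 fun c _ => Finset.card_le_two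
        change (gs _ i).card ≤ _ at this
        omega
      · obtain ⟨c, hc, b, rfl⟩ := (hgs _ _ _).1 hv
        exact hpξ c i b
    obtain ⟨j, hj, hjD, hjP⟩ := hD P₁ (hP₁.trans fun c hc => (hPB c hc).1)
      (hP₁c.trans_le (min_le_left _ _)) (q (P \ P₁, ⟨a, ha⟩))
      (Finset.mem_image_of_mem _ (Finset.mem_univ _))
    have hπj : π ξ (lab j) = (gs (P \ P₁), a) := by rw [hj, hq]
    have hhj : hh ξ j = gs (P \ P₁) := by
      simp only [hh, hπj, if_pos hguessS]
    have hmem : ∀ v, v ∈ gs (P \ P₁) (s ξ j) → v ∈ A' (ξ, j) := fun v hv =>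
      Or.inr (by simpa only [hhj, Finset.mem_coe] using hv)
    refine ⟨(ξ, j), by simp only [hπj], ?_, fun c hc => ?_⟩
    · rintro v (⟨v, hv, rfl⟩ | hv) c hfc
      · refine Finset.mem_filter.2 ⟨hjD v hv c hfc, ?_⟩
        by_contra hcB
        exact lt_irrefl _ (hsmall _ c hcB hfc)
      · simp only [hhj] at hv
        obtain ⟨c', hc', b, rfl⟩ := (hgs _ _ _).1 hv
        have hc'P := (Finset.mem_sdiff.1 hc').1
        rw [(hp c' (hPB c' hc'P).2).2] at hfc
        obtain rfl := Option.some.inj hfc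
        exact hP hc'P
    · by_cases hcP : c ∈ P₁
      · obtain ⟨x, hx, y, hy, hxy, hfx, hfy⟩ := hjP c hcP
        exact ⟨(ξ, x), Or.inl ⟨x, hx, rfl⟩, (ξ, y), Or.inl ⟨y, hy, rfl⟩,
          fun h => hxy (congrArg Prod.snd h), hfx, hfy⟩
      · have hcS : c ∈ P \ P₁ := Finset.mem_sdiff.2 ⟨hc, hcP⟩
        obtain ⟨h1, h2⟩ := hp c (hPB c hc).2
        exact ⟨_, hmem _ ((hgs _ _ _).2 ⟨c, hcS, true, rfl⟩), _,
          hmem _ ((hgs _ _ _).2 ⟨c, hcS, false, rfl⟩),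
          fun h => Bool.noConfusion (h1 _ _ _ _ h).2, h2 _ _, h2 _ _⟩

/-! ### The lower bound and the conclusion -/

theorem exists_guessingFamily (hGCH : GCH.{u}) {κ : Cardinal.{u}} (hκ : ℵ₀ ≤ κ) (m l : ℕ) :
    Nonempty (GuessingFamily (Order.succ^[m] κ) κ (m + 1) l) := by
  induction m with
  | zero => simpa using exists_guessingFamily_base hκ l
  | succ m ih =>
    obtain ⟨G⟩ := ih
    obtain ⟨h1, h2⟩ := aleph0_le_iterate_succ hκ m
    rw [Function.iterate_succ_apply']
    exact exists_guessingFamily_succ hκ h1 (hGCH _ h2) G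

/-- A guessing family gives a system without a weak conflict free coloring with few colors. -/
theorem GuessingFamily.exists_isSystem {lam κ : Cardinal.{u}} (hκ : ℵ₀ ≤ κ) {n l : ℕ}
    (G : GuessingFamily lam κ n l) : ∃ (α : Type u) (𝒜 : Set (Set α)),
      IsSystem 𝒜 lam κ ((2 * l + 1 : ℕ) : Cardinal.{u}) ∧
      ∀ C : Type u, #C ≤ ((n * l : ℕ) : Cardinal.{u}) →
        ∀ f : α → Option C, ¬ IsWeakCFColoring 𝒜 f := by
  classical
  have hlt : ∀ i j, i ≠ j → #(G.A i ∩ G.A j : Set G.V) < ((2 * l + 1 : ℕ) : Cardinal.{u}) := by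
    intro i j hij
    obtain ⟨E, hE, hEc⟩ := G.inter i j hij
    refine (mk_le_mk_of_subset hE).trans_lt ?_
    rw [Finset.coe_sort_coe, mk_coe_finset]
    exact_mod_cast Nat.lt_succ_of_le hEc
  have hinj : Function.Injective G.A := by
    intro i j h
    by_contra hij
    have h1 := hlt i j hij
    rw [← h, Set.inter_self, G.card_mem] at h1
    exact absurd (hκ.trans_lt h1) natCast_lt_aleph0.not_gt
  refine ⟨G.V, Set.range G.A, ⟨?_, ?_, ?_⟩, fun C hC f hf => ?_⟩
  · rw [mk_range_eq _ hinj]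
    refine le_antisymm G.card_index ?_
    refine G.card_label.ge.trans ?_
    refine mk_le_of_surjective (f := G.lab) fun a => ?_
    -- Guessing against the empty coloring shows that every label occurs, so there are at least
    -- `lam` indices.
    obtain ⟨D, hD⟩ := G.guess PUnit (fun _ => none) {a}
    obtain ⟨j, hj, -⟩ := hD ∅ (Finset.empty_subset _) (by simp) a (by simp)
    exact ⟨j, hj⟩
  · rintro _ ⟨j, rfl⟩
    exact G.card_mem j
  · rintro _ ⟨i, rfl⟩ _ ⟨j, rfl⟩ hij
    exact hlt i j fun h => hij (by rw [h])
  · have : Finite C := lt_aleph0_iff_finite.1 (hC.trans_lt natCast_lt_aleph0)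
    have := Fintype.ofFinite C
    have hC' : Fintype.card C ≤ n * l := by
      rw [mk_fintype] at hC; exact_mod_cast hC
    have hL : Nonempty G.L := by
      obtain ⟨v⟩ := G.nonempty
      rw [← mk_ne_zero_iff, G.card_label]
      rintro h
      exact absurd (h ▸ G.card_ground) (not_le.2 (pos_iff_ne_zero.2 (mk_ne_zero_iff.2 ⟨v⟩)))
    obtain ⟨a⟩ := hL
    obtain ⟨D, hD⟩ := G.guess C f {a}
    -- With so few colors `P` may be all of `D`, so each color seen on the set is seen twice.
    obtain ⟨j, -, hjD, hjP⟩ := hD D subset_rfl ((Finset.card_le_univ D).trans hC') a (by simp)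
    obtain ⟨c, hc⟩ := hf.conflictFree (G.A j) ⟨j, rfl⟩
    obtain ⟨v, hv⟩ := mk_set_eq_one_iff.1 hc
    have hvm : v ∈ G.A j ∩ f ⁻¹' {some c} := by rw [hv]; rfl
    obtain ⟨x, hx, y, hy, hxy, hfx, hfy⟩ := hjP c (hjD v hvm.1 c hvm.2)
    have hx' : x ∈ G.A j ∩ f ⁻¹' {some c} := ⟨hx, hfx⟩
    have hy' : y ∈ G.A j ∩ f ⁻¹' {some c} := ⟨hy, hfy⟩
    rw [hv] at hx' hy'
    exact hxy (hx'.trans hy'.symm)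

end ConflictFree

theorem mainTheorem5 (hGCH : ConflictFree.GCH.{u}) (κ : Cardinal.{u})
    (hκ : Cardinal.aleph0 ≤ κ) (m l : ℕ) (hl : 0 < l) :
    ConflictFree.wChiCF (Order.succ^[m] κ) κ ((2 * l + 1 : ℕ) : Cardinal.{u}) =
      (((m + 1) * l + 1 : ℕ) : Cardinal.{u}) := by
  have hκ0 : κ ≠ 0 := (Cardinal.aleph0_pos.trans_le hκ).ne'
  refine le_antisymm (csSup_le' ?_) ?_
  · rintro _ ⟨α, 𝒜, h𝒜, rfl⟩
    refine csInf_le' ⟨ULift.{u} (Fin ((m + 1) * l + 1)), by simp, ?_⟩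
    refine ConflictFree.exists_isWeakCFColoring hκ (2 * l) m ?_ 𝒜 h𝒜
    rw [Fintype.card_ulift, Fintype.card_fin]
    have : m * (2 * l) + (2 * l + 1) + 1 = 2 * ((m + 1) * l + 1) := by ring
    omega
  · obtain ⟨G⟩ := ConflictFree.exists_guessingFamily hGCH hκ m l
    obtain ⟨α, 𝒜, h𝒜, hno⟩ := G.exists_isSystem hκ
    refine le_csSup_of_le (ConflictFree.bddAbove_weakCFNumbers _ _ _ hκ0) ⟨α, 𝒜, h𝒜, rfl⟩ ?_
    refine le_csInf ⟨_, ConflictFree.mk_sUnion_mem_weakCFColorCounts 𝒜 fun A hA => ?_⟩ ?_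
    · rw [← Set.nonempty_coe_sort, ← Cardinal.mk_ne_zero_iff, h𝒜.card_mem A hA]
      exact hκ0
    · rintro _ ⟨C, rfl, f, hf⟩
      by_contra! h
      refine hno C ?_ f hf
      obtain ⟨N, hN⟩ := Cardinal.lt_aleph0.1 (h.trans Cardinal.natCast_lt_aleph0)
      rw [hN] at h ⊢
      exact_mod_cast Nat.lt_succ_iff.1 (by exact_mod_cast h)
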